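/- Let $n\ge 1$. A cube is a cube $Q\subset\mathbb R^n$ with sides parallel to the axes; $\langle f\rangle_Q=\frac1{|Q|}\int_Q f$; $\mathcal D(Q)$ is the set of cubes obtained by repeatedly subdividing $Q$ and its descendants into $2^n$ congruent subcubes; and $M_Qf=\sup_{P\in\mathcal D(Q)}\langle|f|\rangle_P\,\chi_P$ is the local dyadic maximal operator. A quasi-Banach function space over $Q$ is an order ideal $Y$ of the space $L^0(Q)$ of measurable real functions on $Q$ (modulo null sets), with a quasi-norm such that: $\|f\|_Y\le\|g\|_Y$ whenever $f,g\in Y$ and $|f|\le|g|$; some $f\in Y$ is positive a.e. on $Q$; and whenever $f_k\in Y$, $0\le f_k\uparrow f\in L^0(Q)$ a.e. and $\sup_k\|f_k\|_Y<\infty$, then $f\in Y$ and $\|f\|_Y=\sup_k\|f_k\|_Y$. We put $\|f\|_Y=\infty$ if $f\notin Y$. Let $X=\{X_Q\}$ be a family of normalized quasi-Banach function spaces: for each cube $Q$, $X_Q$ is a quasi-Banach function space over $Q$, and there are constants $0<c\le C<\infty$ with $c\le\|\chi_Q\|_{X_Q}\le C$ for all $Q$. Let $\mathrm{BMO}$,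 $\mathrm{BMO}_X$ and $\mathrm{BMO}_{MX}$ be the spaces of all locally integrable $f\colon\mathbb R^n\to\mathbb R$ for which, respectively, $$\|f\|_{\mathrm{BMO}}=\sup_Q\frac1{|Q|}\int_Q|f-\langle f\rangle_Q|,\qquad \|f\|_{\mathrm{BMO}_X}=\sup_Q\|f-\langle f\rangle_Q\|_{X_Q},\qquad \|f\|_{\mathrm{BMO}_{MX}}=\sup_Q\|M_Q(f-\langle f\rangle_Q)\|_{X_Q}$$ is finite. Then the following are equivalent: (i) $\mathrm{BMO}\hookrightarrow\mathrm{BMO}_X$, i.e. $\mathrm{BMO}\subset\mathrm{BMO}_X$ and there is a constant $C_1>0$ with $\|f\|_{\mathrm{BMO}_X}\le C_1\|f\|_{\mathrm{BMO}}$ for all $f\in\mathrm{BMO}$; (ii) $\mathrm{BMO}=\mathrm{BMO}_{MX}$, i.e. the two spaces have the same elements and there are constants $c_2,C_2>0$ with $c_2\|f\|_{\mathrm{BMO}}\le\|f\|_{\mathrm{BMO}_{MX}}\le C_2\|f\|_{\mathrm{BMO}}$ for all $f\in\mathrm{BMO}$. -/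

import Mathlib

open MeasureTheory Filter Topology Set
open scoped ENNReal NNReal

noncomputable section

namespace BMOX

/-- A quasi-Banach function space with the Fatou property over the measure space `(α, μ)`:
an order ideal of `L⁰(μ)` (a.e. classes of measurable real functions) with a quasi-norm.
The quasi-triangle constant may depend on the space. Completeness is a consequence of the
Fatou property, hence it is not listed. -/
structure QuasiBanachFunctionSpace {α : Type*} [MeasurableSpace α] (μ : Measure α) where
  /-- The elements of the space. -/
  carrier : Submodule ℝ (α →ₘ[μ] ℝ)
  /-- The quasi-norm. -/
  qnorm : carrier → ℝ
  qnorm_nonneg : ∀ f, 0 ≤ qnorm f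
  qnorm_eq_zero_iff : ∀ f, qnorm f = 0 ↔ f = 0
  qnorm_smul : ∀ (a : ℝ) (f : carrier), qnorm (a • f) = |a| * qnorm f
  qnorm_add_le : ∃ K : ℝ, 1 ≤ K ∧ ∀ f g, qnorm (f + g) ≤ K * (qnorm f + qnorm g)
  /-- The space is an order ideal. -/
  ideal : ∀ (f : carrier) (g : α →ₘ[μ] ℝ), |g| ≤ |f.1| → g ∈ carrier
  /-- Compatibility of the quasi-norm with the order. -/
  compat : ∀ f g : carrier, |f.1| ≤ |g.1| → qnorm f ≤ qnorm g
  /-- There is a weak order unit. -/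
  weak_order_unit : ∃ f : carrier, ∀ᵐ x ∂μ, 0 < f.1 x
  /-- The Fatou property. -/
  fatou : ∀ (f : ℕ → carrier) (g : α →ₘ[μ] ℝ), (∀ k, 0 ≤ (f k).1) →
    Monotone (fun k => (f k).1) →
    (∀ᵐ x ∂μ, Tendsto (fun k => (f k).1 x) atTop (𝓝 (g x))) →
    BddAbove (range fun k => qnorm (f k)) →
    ∃ hg : g ∈ carrier, qnorm ⟨g, hg⟩ = ⨆ k, qnorm (f k)

/-- The quasi-norm of an extended-real function: the quasi-norm of its a.e. class if this class
is an element of the space, and `∞` otherwise (there is at most one `g` in the infimum). -/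
def QuasiBanachFunctionSpace.eNorm {α : Type*} [MeasurableSpace α] {μ : Measure α}
    (X : QuasiBanachFunctionSpace μ) (F : α → EReal) : ℝ≥0∞ :=
  ⨅ (g : X.carrier) (_ : (fun x => ((g.1 x : ℝ) : EReal)) =ᵐ[μ] F), ENNReal.ofReal (X.qnorm g)

/-- A (half-open) cube in `ℝⁿ` with sides parallel to the axes. -/
structure Cube (n : ℕ) where
  /-- The corner with the smallest coordinates. -/
  corner : Fin n → ℝ
  /-- The side length. -/
  side : ℝ
  side_pos : 0 < side

namespace Cube

variable {n : ℕ}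

/-- The points of the cube. -/
def toSet (Q : Cube n) : Set (Fin n → ℝ) :=
  {x | ∀ i, Q.corner i ≤ x i ∧ x i < Q.corner i + Q.side}

/-- One of the `2 ^ n` congruent subcubes of half the side length. -/
def child (Q : Cube n) (ε : Fin n → Fin 2) : Cube n where
  corner := fun i => Q.corner i + ((ε i : ℕ) : ℝ) * (Q.side / 2)
  side := Q.side / 2
  side_pos := half_pos Q.side_pos

/-- `IsDyadic Q P`: the cube `P` is obtained by repeated subdivision of `Q`. -/
inductive IsDyadic (Q : Cube n) : Cube n → Prop
  | refl : IsDyadic Q Q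
  | child (P : Cube n) (ε : Fin n → Fin 2) : IsDyadic Q P → IsDyadic Q (P.child ε)

end Cube

/-- The mean `⟨f⟩_Q` of `f` over `Q`. -/
def mean {n : ℕ} (f : (Fin n → ℝ) → ℝ) (Q : Cube n) : ℝ :=
  ⨍ x in Q.toSet, f x

/-- The local dyadic maximal operator `M_Q`. -/
def localMaximal {n : ℕ} (Q : Cube n) (f : (Fin n → ℝ) → ℝ) (x : Fin n → ℝ) : ℝ≥0∞ :=
  ⨆ (P : Cube n) (_ : Q.IsDyadic P),
    P.toSet.indicator (fun _ => ⨍⁻ y in P.toSet, ‖f y‖ₑ ∂volume) x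

/-- A quasi-Banach function space over each cube. -/
abbrev Family (n : ℕ) : Type :=
  (Q : Cube n) → QuasiBanachFunctionSpace (volume.restrict Q.toSet)

/-- The family is normalized: `‖χ_Q‖_{X_Q} ≃ 1` with constants independent of `Q`. -/
def Family.IsNormalized {n : ℕ} (X : Family n) : Prop :=
  ∃ c C : ℝ≥0, 0 < c ∧ ∀ Q : Cube n,
    (c : ℝ≥0∞) ≤ (X Q).eNorm (Q.toSet.indicator fun _ => 1) ∧
    (X Q).eNorm (Q.toSet.indicator fun _ => 1) ≤ C

/-- `‖f‖_{BMO}`. -/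
def bmoNorm {n : ℕ} (f : (Fin n → ℝ) → ℝ) : ℝ≥0∞ :=
  ⨆ Q : Cube n, ⨍⁻ x in Q.toSet, ‖f x - mean f Q‖ₑ ∂volume

/-- `‖f‖_{BMO_X}`. -/
def bmoXNorm {n : ℕ} (X : Family n) (f : (Fin n → ℝ) → ℝ) : ℝ≥0∞ :=
  ⨆ Q : Cube n, (X Q).eNorm fun x => ((f x - mean f Q : ℝ) : EReal)

/-- `‖f‖_{BMO_{MX}}`. -/
def bmoMXNorm {n : ℕ} (X : Family n) (f : (Fin n → ℝ) → ℝ) : ℝ≥0∞ :=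
  ⨆ Q : Cube n, (X Q).eNorm fun x =>
    ((localMaximal Q (fun y => f y - mean f Q) x : ℝ≥0∞) : EReal)

/-- The locally integrable functions on which `N` is finite. -/
def space {n : ℕ} (N : ((Fin n → ℝ) → ℝ) → ℝ≥0∞) : Set ((Fin n → ℝ) → ℝ) :=
  {f | LocallyIntegrable f volume ∧ N f < ∞}

/-- Continuous embedding `space N₁ ↪ space N₂`. -/
def Embeds {n : ℕ} (N₁ N₂ : ((Fin n → ℝ) → ℝ) → ℝ≥0∞) : Prop :=
  space N₁ ⊆ space N₂ ∧ ∃ C : ℝ≥0, 0 < C ∧ ∀ f ∈ space N₁, N₂ f ≤ C * N₁ f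

/-- The two spaces have the same elements and equivalent (semi-, quasi-)norms. -/
def SameSpace {n : ℕ} (N₁ N₂ : ((Fin n → ℝ) → ℝ) → ℝ≥0∞) : Prop :=
  space N₁ = space N₂ ∧ ∃ c C : ℝ≥0, 0 < c ∧ 0 < C ∧
    ∀ f ∈ space N₁, c * N₁ f ≤ N₂ f ∧ N₂ f ≤ C * N₁ f

end BMOX

end

/-!
# `BMO` embeds into `BMO_X` if and only if `BMO = BMO_{MX}`

Two of the estimates hold for every normalized family. The Lebesgue differentiation theorem gives
`|f - ⟨f⟩_Q| ≤ M_Q (f - ⟨f⟩_Q)` a.e. on `Q`, hence `‖f‖_{BMO_X} ≤ ‖f‖_{BMO_{MX}}`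
(`bmoXNorm_le_bmoMXNorm`); and `M_Q (f - ⟨f⟩_Q) ≥ ⟨|f - ⟨f⟩_Q|⟩_Q` on `Q` together with
`‖χ_Q‖ ≥ c` gives `c ‖f‖_{BMO} ≤ ‖f‖_{BMO_{MX}}` (`mul_bmoNorm_le_bmoMXNorm`).

The remaining estimate, `‖f‖_{BMO_{MX}} ≲ ‖f‖_{BMO}` if `BMO` embeds into `BMO_X`, follows from a
pointwise statement (`exists_bmoNorm_le_and_localMaximal_le`): for every cube `Q` there is a
function `g` on the whole space with `‖g‖_{BMO} ≲ ‖f‖_{BMO}` and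
`M_Q (f - ⟨f⟩_Q) ≤ |g - ⟨g⟩_Q|` a.e. on `Q`. It is constructed as follows, for some `B > ‖f‖_{BMO}`.

* Descend the dyadic tree below `Q`, comparing `f` to a constant `a`, at first `a = ⟨f⟩_Q`. When the
  mean of `|f - a|` over a cube `P` exceeds `2 B`, the cube is stopped and `a` is replaced by
  `⟨f⟩_P`. The stopped cubes satisfy a Carleson packing condition
  (`sum_volume_thickening_stopSet_le`), and `M_Q (f - ⟨f⟩_Q)` is at most a multiple of
  `B * (1 + N)`, where `N x` is the number of stopped cubes around `x`
  (`setLAverage_le_of_isDescendant`).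
* Replace `N` by the sum `h` of Lipschitz bumps around the stopped cubes (`stopSum`). On a cube `R`,
  the bumps at larger scales oscillate little because their Lipschitz constants form a geometric
  series, and the others have a bounded mean by the Carleson condition. Hence `h` is in `BMO` with
  norm depending on `n` only (`exists_setLIntegral_stopSum_sub_le`). Neither the John–Nirenberg
  inequality nor an extension theorem for `BMO` of a cube is needed.
* The constants in the quasi-triangle inequalities of the spaces `X_Q` need not be bounded, so the
  terms `1` and `⟨h⟩_Q` cannot be split off in `X_Q`. Instead, a multiple of the indicator function
  of a set `E ⊆ Q`, on which `h` is bounded, is subtracted from `h`; this achieves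
  `1 + h ≤ |(h - A χ_E) - ⟨h - A χ_E⟩_Q|` on all of `Q` (`exists_one_add_le_abs_sub_mean`).
-/

namespace BMOX

namespace Cube

variable {n : ℕ}

/-! ### Cubes and their dyadic subcubes -/

theorem toSet_eq_pi (Q : Cube n) :
    Q.toSet = univ.pi fun i => Ico (Q.corner i) (Q.corner i + Q.side) := by
  ext x; simp [toSet]

theorem measurableSet_toSet (Q : Cube n) : MeasurableSet Q.toSet := by
  rw [toSet_eq_pi]
  exact MeasurableSet.univ_pi fun _ => measurableSet_Ico

theorem volume_toSet (Q : Cube n) : volume Q.toSet = ENNReal.ofReal (Q.side ^ n) := by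
  rw [toSet_eq_pi, Real.volume_pi_Ico]
  simp [ENNReal.ofReal_pow Q.side_pos.le]

theorem volume_ne_zero (Q : Cube n) : volume Q.toSet ≠ 0 := by
  rw [volume_toSet, Ne, ENNReal.ofReal_eq_zero, not_le]
  exact pow_pos Q.side_pos n

theorem volume_ne_top (Q : Cube n) : volume Q.toSet ≠ ∞ := by
  rw [volume_toSet]; exact ENNReal.ofReal_ne_top

theorem corner_mem (Q : Cube n) : Q.corner ∈ Q.toSet := fun _ =>
  ⟨le_rfl, lt_add_of_pos_right _ Q.side_pos⟩

/-- The centre of a cube. -/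
noncomputable def center (Q : Cube n) : Fin n → ℝ := fun i => Q.corner i + Q.side / 2

theorem toSet_ae_eq_closedBall (Q : Cube n) :
    Q.toSet =ᵐ[volume] Metric.closedBall Q.center (Q.side / 2) := by
  rw [toSet_eq_pi, closedBall_pi _ (half_pos Q.side_pos).le]
  have h : ∀ i, Metric.closedBall (Q.center i) (Q.side / 2) =
      Icc (Q.corner i) (Q.corner i + Q.side) := by
    intro i
    rw [Real.closedBall_eq_Icc, center]
    congr 1 <;> ring
  simp only [h]
  rw [Set.pi_univ_Icc]
  exact Measure.univ_pi_Ico_ae_eq_Icc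

theorem toSet_subset_closedBall (Q : Cube n) :
    Q.toSet ⊆ Metric.closedBall Q.center (Q.side / 2) := by
  intro x hx
  rw [Metric.mem_closedBall, dist_pi_le_iff (half_pos Q.side_pos).le]
  intro i
  rw [Real.dist_eq, abs_le, center]
  constructor <;> linarith [(hx i).1, (hx i).2]

theorem dist_le_side {Q : Cube n} {x y : Fin n → ℝ} (hx : x ∈ Q.toSet) (hy : y ∈ Q.toSet) :
    dist x y ≤ Q.side := by
  rw [dist_pi_le_iff Q.side_pos.le]
  intro i
  rw [Real.dist_eq, abs_le]
  constructor <;> linarith [(hx i).1, (hx i).2, (hy i).1, (hy i).2]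

/-- The ball with the centre of `Q` and `t / 2` times its side length is `t Q`, up to its
boundary. -/
theorem volume_closedBall_center (Q : Cube n) {t : ℕ} :
    volume (Metric.closedBall Q.center (t * Q.side / 2)) = (t : ℝ≥0∞) ^ n * volume Q.toSet := by
  have h := Q.side_pos
  rw [Real.volume_pi_closedBall _ (by positivity), volume_toSet, Fintype.card_fin,
    mul_div_cancel₀ _ two_ne_zero, mul_pow, ENNReal.ofReal_mul (by positivity),
    ENNReal.ofReal_pow (by positivity), ENNReal.ofReal_natCast]

theorem volume_thickening_le (Q : Cube n) :
    volume (Metric.thickening Q.side Q.toSet) ≤ 3 ^ n * volume Q.toSet := by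
  have h := Q.volume_closedBall_center (t := 3)
  push_cast at h
  rw [← h]
  refine measure_mono fun x hx => ?_
  obtain ⟨y, hy, hxy⟩ := Metric.mem_thickening_iff.1 hx
  have := Q.toSet_subset_closedBall hy
  rw [Metric.mem_closedBall] at this ⊢
  linarith [dist_triangle x y Q.center]

theorem mem_child_iff {Q : Cube n} {ε : Fin n → Fin 2} {x : Fin n → ℝ} :
    x ∈ (Q.child ε).toSet ↔ x ∈ Q.toSet ∧ ∀ i, ε i = 0 ↔ x i < Q.corner i + Q.side / 2 := by
  have key : ∀ i, (Q.corner i + ((ε i : ℕ) : ℝ) * (Q.side / 2) ≤ x i ∧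
      x i < Q.corner i + ((ε i : ℕ) : ℝ) * (Q.side / 2) + Q.side / 2) ↔
      ((Q.corner i ≤ x i ∧ x i < Q.corner i + Q.side) ∧
        (ε i = 0 ↔ x i < Q.corner i + Q.side / 2)) := by
    intro i
    have h := Q.side_pos
    rcases Fin.exists_fin_two.1 ⟨ε i, rfl⟩ with e | e <;> rw [e]
    · constructor
      · intro hx
        norm_num at hx ⊢
        exact ⟨⟨hx.1, by linarith⟩, hx.2⟩
      · intro hx
        norm_num at hx ⊢
        exact ⟨hx.1.1, hx.2⟩
    · constructor
      · intro hx
        norm_num at hx ⊢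
        exact ⟨⟨by linarith, by linarith⟩, hx.1⟩
      · intro hx
        norm_num at hx ⊢
        exact ⟨hx.2, by linarith⟩
  change (∀ i, Q.corner i + ((ε i : ℕ) : ℝ) * (Q.side / 2) ≤ x i ∧
      x i < Q.corner i + ((ε i : ℕ) : ℝ) * (Q.side / 2) + Q.side / 2) ↔
    (∀ i, Q.corner i ≤ x i ∧ x i < Q.corner i + Q.side) ∧ _
  rw [← forall_and]
  exact forall_congr' key

theorem child_subset (Q : Cube n) (ε : Fin n → Fin 2) : (Q.child ε).toSet ⊆ Q.toSet :=
  fun _ hx => (mem_child_iff.1 hx).1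

theorem exists_mem_child {Q : Cube n} {x : Fin n → ℝ} (hx : x ∈ Q.toSet) :
    ∃ ε, x ∈ (Q.child ε).toSet := by
  classical
  refine ⟨fun i => if x i < Q.corner i + Q.side / 2 then 0 else 1, mem_child_iff.2 ⟨hx, ?_⟩⟩
  intro i
  by_cases h : x i < Q.corner i + Q.side / 2 <;> simp [h]

theorem iUnion_child (Q : Cube n) : ⋃ ε, (Q.child ε).toSet = Q.toSet :=
  Subset.antisymm (iUnion_subset Q.child_subset) fun _ hx => mem_iUnion.2 (exists_mem_child hx)

theorem pairwise_disjoint_child (Q : Cube n) :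
    Pairwise (Function.onFun Disjoint fun ε => (Q.child ε).toSet) := by
  intro ε ε' hne
  refine disjoint_left.2 fun x hx hx' => hne ?_
  ext1 i
  have h := ((mem_child_iff.1 hx).2 i).trans ((mem_child_iff.1 hx').2 i).symm
  omega

theorem setLIntegral_eq_sum_child (Q : Cube n) (F : (Fin n → ℝ) → ℝ≥0∞) :
    ∫⁻ x in Q.toSet, F x = ∑ ε, ∫⁻ x in (Q.child ε).toSet, F x := by
  rw [← iUnion_child, lintegral_iUnion (fun ε => (Q.child ε).measurableSet_toSet)
    Q.pairwise_disjoint_child, tsum_fintype]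

theorem volume_inter_eq_sum_child (Q : Cube n) {U : Set (Fin n → ℝ)} (hU : MeasurableSet U) :
    volume (Q.toSet ∩ U) = ∑ ε, volume ((Q.child ε).toSet ∩ U) := by
  have h := Q.setLIntegral_eq_sum_child (U.indicator 1)
  simpa only [lintegral_indicator_one hU, Measure.restrict_apply hU, inter_comm U] using h

theorem volume_child (Q : Cube n) (ε : Fin n → Fin 2) :
    volume Q.toSet = 2 ^ n * volume (Q.child ε).toSet := by
  have h2 : (2 : ℝ≥0∞) ^ n = ENNReal.ofReal (2 ^ n) := by
    rw [ENNReal.ofReal_pow two_pos.le, ENNReal.ofReal_ofNat]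
  rw [volume_toSet, volume_toSet, h2, ← ENNReal.ofReal_mul (by positivity)]
  congr 1
  change _ = 2 ^ n * (Q.side / 2) ^ n
  rw [← mul_pow, mul_div_cancel₀ _ two_ne_zero]

/-- `IsDescendant k Q P`: the cube `P` is obtained from `Q` by `k` subdivisions. The recursion
removes the coarsest subdivision first, opposite to the one of `IsDyadic`. -/
def IsDescendant : ℕ → Cube n → Cube n → Prop
  | 0, Q, P => P = Q
  | k + 1, Q, P => ∃ ε, IsDescendant k (Q.child ε) P

theorem IsDescendant.child {k : ℕ} {Q P : Cube n} (h : IsDescendant k Q P) (ε : Fin n → Fin 2) :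
    IsDescendant (k + 1) Q (P.child ε) := by
  induction k generalizing Q with
  | zero => exact ⟨ε, by rw [IsDescendant] at h ⊢; rw [h]⟩
  | succ k ih =>
    obtain ⟨ε', h⟩ := h
    exact ⟨ε', ih h⟩

theorem IsDyadic.exists_isDescendant {Q P : Cube n} (h : Q.IsDyadic P) :
    ∃ k, IsDescendant k Q P := by
  induction h with
  | refl => exact ⟨0, rfl⟩
  | child P ε _ ih => exact ih.imp' (· + 1) fun _ h => h.child ε

theorem IsDescendant.subset {k : ℕ} {Q P : Cube n} (h : IsDescendant k Q P) :
    P.toSet ⊆ Q.toSet := by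
  induction k generalizing Q with
  | zero => rw [IsDescendant] at h; rw [h]
  | succ k ih =>
    obtain ⟨ε, h⟩ := h
    exact (ih h).trans (Q.child_subset ε)

theorem countable_isDyadic (Q : Cube n) : {P | Q.IsDyadic P}.Countable := by
  have h : ∀ (k : ℕ) (Q : Cube n), {P | IsDescendant k Q P}.Countable := by
    intro k
    induction k with
    | zero => exact fun Q => countable_singleton Q
    | succ k ih =>
      intro Q
      simp only [IsDescendant, ofPred_exists]
      exact countable_iUnion fun ε => ih _
  refine (countable_iUnion fun k => h k Q).mono fun P hP => mem_iUnion.2 ?_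
  exact hP.exists_isDescendant

theorem exists_isDyadic_mem {Q : Cube n} {x : Fin n → ℝ} (hx : x ∈ Q.toSet) (k : ℕ) :
    ∃ P, Q.IsDyadic P ∧ x ∈ P.toSet ∧ P.side = Q.side / 2 ^ k := by
  induction k with
  | zero => exact ⟨Q, .refl, hx, by simp⟩
  | succ k ih =>
    obtain ⟨P, hP, hxP, hs⟩ := ih
    obtain ⟨ε, hε⟩ := exists_mem_child hxP
    refine ⟨P.child ε, .child P ε hP, hε, ?_⟩
    change P.side / 2 = _
    rw [hs, pow_succ, div_div]

end Cube

variable {n : ℕ}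

theorem _root_.MeasureTheory.LocallyIntegrable.integrableOn_cube {f : (Fin n → ℝ) → ℝ}
    (hf : LocallyIntegrable f volume) (Q : Cube n) : IntegrableOn f Q.toSet volume :=
  (hf.integrableOn_isCompact (isCompact_closedBall Q.center (Q.side / 2))).mono_set
    Q.toSet_subset_closedBall

/-! ### Means over cubes -/

theorem mean_sub_const {f : (Fin n → ℝ) → ℝ} (hf : LocallyIntegrable f volume) (P : Cube n)
    (a : ℝ) : mean f P - a = ⨍ x in P.toSet, (f x - a) := by
  rw [mean, setAverage_eq, setAverage_eq,
    integral_sub (hf.integrableOn_cube P) (integrableOn_const P.volume_ne_top),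
    smul_sub, setIntegral_const, smul_smul, inv_mul_cancel₀, one_smul]
  exact (ENNReal.toReal_pos P.volume_ne_zero P.volume_ne_top).ne'

theorem enorm_mean_sub_mul_volume_le {f : (Fin n → ℝ) → ℝ} (hf : LocallyIntegrable f volume)
    (P : Cube n) (a : ℝ) :
    ‖mean f P - a‖ₑ * volume P.toSet ≤ ∫⁻ x in P.toSet, ‖f x - a‖ₑ := by
  have h0 := (ENNReal.toReal_pos P.volume_ne_zero P.volume_ne_top).ne'
  refine le_of_eq_of_le ?_ (enorm_integral_le_lintegral_enorm _)
  rw [mean_sub_const hf, setAverage_eq, enorm_smul, enorm_inv, Measure.real]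
  · rw [Real.enorm_of_nonneg ENNReal.toReal_nonneg, ENNReal.ofReal_toReal P.volume_ne_top,
      mul_comm, ← mul_assoc, ENNReal.mul_inv_cancel P.volume_ne_zero P.volume_ne_top, one_mul]
  · exact h0

/-- In the definition of `BMO`, the means may be replaced by arbitrary constants. -/
theorem bmoNorm_le_of_forall_exists {f : (Fin n → ℝ) → ℝ} (hf : LocallyIntegrable f volume)
    {K : ℝ≥0∞}
    (h : ∀ R : Cube n, ∃ c : ℝ, ∫⁻ x in R.toSet, ‖f x - c‖ₑ ≤ K * volume R.toSet) :
    bmoNorm f ≤ 2 * K := by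
  refine iSup_le fun R => ?_
  obtain ⟨c, hc⟩ := h R
  rw [setLAverage_eq]
  refine ENNReal.div_le_of_le_mul ?_
  calc _ ≤ ∫⁻ x in R.toSet, (‖f x - c‖ₑ + ‖mean f R - c‖ₑ) := by
        refine lintegral_mono fun x => ?_
        rw [← sub_sub_sub_cancel_right (f x) (mean f R) c]
        exact enorm_sub_le
    _ = (∫⁻ x in R.toSet, ‖f x - c‖ₑ) + ‖mean f R - c‖ₑ * volume R.toSet := by
        rw [lintegral_add_right _ measurable_const, setLIntegral_const]
    _ ≤ K * volume R.toSet + K * volume R.toSet :=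
        add_le_add hc ((enorm_mean_sub_mul_volume_le hf R c).trans hc)
    _ = _ := by ring

theorem setLIntegral_le_bmoNorm (f : (Fin n → ℝ) → ℝ) (P : Cube n) :
    ∫⁻ x in P.toSet, ‖f x - mean f P‖ₑ ≤ bmoNorm f * volume P.toSet := by
  rw [← ENNReal.div_le_iff P.volume_ne_zero P.volume_ne_top, ← setLAverage_eq]
  exact le_iSup (fun Q : Cube n => ⨍⁻ x in Q.toSet, ‖f x - mean f Q‖ₑ ∂volume) P

/-! ### Stopping cubes -/

section Stopping

variable (f : (Fin n → ℝ) → ℝ) (B : ℝ≥0∞)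

/-- The cube `P` is stopped relative to the constant `a` if the mean of `|f - a|` over `P` is
larger than `2 * B`. -/
def IsStopped (P : Cube n) (a : ℝ) : Prop :=
  2 * B * volume P.toSet < ∫⁻ x in P.toSet, ‖f x - a‖ₑ

open Classical in
/-- The constant to which the children of `P` are compared, if `P` itself is compared to `a`: it
is replaced by the mean of `f` over `P` if `P` is stopped. -/
noncomputable def nextValue (P : Cube n) (a : ℝ) : ℝ :=
  if IsStopped f B P a then mean f P else a

/-- The union of the cubes that are obtained from `P` by `j + 1` subdivisions and are stopped,
if the descendants of `P` are compared to `a` until the first of them is stopped. -/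
def stopSet : ℕ → Cube n → ℝ → Set (Fin n → ℝ)
  | 0, P, a => ⋃ (ε) (_ : IsStopped f B (P.child ε) a), (P.child ε).toSet
  | j + 1, P, a => ⋃ ε, stopSet j (P.child ε) (nextValue f B (P.child ε) a)

variable {f B}

theorem stopSet_subset (j : ℕ) (P : Cube n) (a : ℝ) : stopSet f B j P a ⊆ P.toSet := by
  induction j generalizing P a with
  | zero => exact iUnion_subset fun ε => iUnion_subset fun _ => P.child_subset ε
  | succ j ih => exact iUnion_subset fun ε => (ih _ _).trans (P.child_subset ε)

/-- Every cube satisfies the mean estimate with its new constant: either it is stopped and the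
constant is its mean, or it is not stopped. -/
theorem setLIntegral_nextValue_le
    (hf : ∀ P : Cube n, ∫⁻ x in P.toSet, ‖f x - mean f P‖ₑ ≤ B * volume P.toSet)
    (P : Cube n) (a : ℝ) :
    ∫⁻ x in P.toSet, ‖f x - nextValue f B P a‖ₑ ≤ 2 * B * volume P.toSet := by
  rw [nextValue]
  split_ifs with h
  · refine (hf P).trans ?_
    gcongr
    exact le_mul_of_one_le_left zero_le one_le_two
  · exact not_lt.1 h

/-- The Carleson packing condition for the stopping cubes, in the form of an estimate which is
proved by recursion on the number of subdivisions: a stopped cube `P` pays for itself and for all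
the cubes below it, since `|P| + B⁻¹ * ∫_P |f - ⟨f⟩_P| ≤ 2 * |P| ≤ B⁻¹ * ∫_P |f - a|`. -/
theorem sum_volume_thickening_stopSet_le
    (hf : ∀ P : Cube n, ∫⁻ x in P.toSet, ‖f x - mean f P‖ₑ ≤ B * volume P.toSet)
    (J : ℕ) (P : Cube n) (a : ℝ) :
    B * ∑ j ∈ Finset.range J,
        volume (Metric.thickening (P.side / 2 ^ (j + 1)) (stopSet f B j P a)) ≤
      3 ^ n * ∫⁻ x in P.toSet, ‖f x - a‖ₑ := by
  classical
  induction J generalizing P a with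
  | zero => simp
  | succ J ih =>
    have h0 : volume (Metric.thickening (P.side / 2 ^ (0 + 1)) (stopSet f B 0 P a)) ≤
        ∑ ε, if IsStopped f B (P.child ε) a then 3 ^ n * volume (P.child ε).toSet else 0 := by
      rw [stopSet, Metric.thickening_iUnion]
      refine (measure_iUnion_fintype_le _ _).trans (Finset.sum_le_sum fun ε _ => ?_)
      rw [Metric.thickening_iUnion]
      split_ifs with h
      · simp only [h, iUnion_true]
        have := (P.child ε).volume_thickening_le
        rwa [show (P.child ε).side = P.side / 2 ^ (0 + 1) by simp [Cube.child]] at this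
      · simp [h]
    have h1 : ∀ j, volume (Metric.thickening (P.side / 2 ^ (j + 1 + 1))
          (stopSet f B (j + 1) P a)) ≤
        ∑ ε, volume (Metric.thickening ((P.child ε).side / 2 ^ (j + 1))
          (stopSet f B j (P.child ε) (nextValue f B (P.child ε) a))) := by
      intro j
      rw [stopSet, Metric.thickening_iUnion]
      refine (measure_iUnion_fintype_le _ _).trans (Finset.sum_le_sum fun ε _ => ?_)
      rw [show (P.child ε).side / 2 ^ (j + 1) = P.side / 2 ^ (j + 1 + 1) by
        change P.side / 2 / _ = _
        rw [pow_succ' _ (j + 1), div_div]]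
    rw [Finset.sum_range_succ']
    calc _ ≤ B * ((∑ j ∈ Finset.range J, ∑ ε, volume (Metric.thickening
            ((P.child ε).side / 2 ^ (j + 1))
            (stopSet f B j (P.child ε) (nextValue f B (P.child ε) a)))) +
          ∑ ε, if IsStopped f B (P.child ε) a then 3 ^ n * volume (P.child ε).toSet else 0) := by
          gcongr with j _
          exact h1 j
      _ = ∑ ε, (B * (∑ j ∈ Finset.range J, volume (Metric.thickening
            ((P.child ε).side / 2 ^ (j + 1))
            (stopSet f B j (P.child ε) (nextValue f B (P.child ε) a)))) +
          B * if IsStopped f B (P.child ε) a then 3 ^ n * volume (P.child ε).toSet else 0) := by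
          rw [Finset.sum_comm, ← Finset.sum_add_distrib, Finset.mul_sum]
          simp only [mul_add]
      _ ≤ ∑ ε, 3 ^ n * ∫⁻ x in (P.child ε).toSet, ‖f x - a‖ₑ := by
          refine Finset.sum_le_sum fun ε _ => ?_
          refine (add_le_add_left (ih _ _) _).trans ?_
          rw [nextValue]
          split_ifs with h
          · calc _ ≤ 3 ^ n * (B * volume (P.child ε).toSet) +
                  B * (3 ^ n * volume (P.child ε).toSet) := by
                  gcongr
                  exact hf _
              _ = 3 ^ n * (2 * B * volume (P.child ε).toSet) := by ring
              _ ≤ _ := by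
                  gcongr
                  exact h.le
          · simp
      _ = _ := by rw [← Finset.mul_sum, ← P.setLIntegral_eq_sum_child]

/-- If `P` is compared to `a` and is not stopped, then the stopping cubes below `P` have overlap
at most `2 * 3 ^ n` in the mean. -/
theorem sum_volume_thickening_stopSet_le_volume (hB : B ≠ 0) (hB' : B ≠ ∞)
    (hf : ∀ P : Cube n, ∫⁻ x in P.toSet, ‖f x - mean f P‖ₑ ≤ B * volume P.toSet)
    (J : ℕ) {P : Cube n} {a : ℝ}
    (ha : ∫⁻ x in P.toSet, ‖f x - a‖ₑ ≤ 2 * B * volume P.toSet) :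
    ∑ j ∈ Finset.range J,
        volume (Metric.thickening (P.side / 2 ^ (j + 1)) (stopSet f B j P a)) ≤
      2 * 3 ^ n * volume P.toSet := by
  rw [← ENNReal.mul_le_mul_iff_right hB hB']
  refine (sum_volume_thickening_stopSet_le hf J P a).trans ?_
  calc _ ≤ 3 ^ n * (2 * B * volume P.toSet) := by gcongr
    _ = _ := by ring

/-- A local version of the Carleson condition: the stopping cubes of side length at most half the
one of `R` have overlap at most `2 * 15 ^ n` on `R` in the mean. The recursion descends
to the cubes `P` which are not longer than `R`; those whose neighbourhood meets `R` are contained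
in `5 R`. -/
theorem sum_volume_inter_thickening_stopSet_le (hB : B ≠ 0) (hB' : B ≠ ∞)
    (hf : ∀ P : Cube n, ∫⁻ x in P.toSet, ‖f x - mean f P‖ₑ ≤ B * volume P.toSet)
    (J : ℕ) (R : Cube n) {P : Cube n} {a : ℝ}
    (ha : ∫⁻ x in P.toSet, ‖f x - a‖ₑ ≤ 2 * B * volume P.toSet) :
    ∑ j ∈ Finset.range J, (if P.side / 2 ^ j ≤ R.side then
        volume (R.toSet ∩ Metric.thickening (P.side / 2 ^ (j + 1)) (stopSet f B j P a)) else 0) ≤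
      2 * 3 ^ n * volume (P.toSet ∩ Metric.closedBall R.center (5 * R.side / 2)) := by
  induction J generalizing P a with
  | zero => simp
  | succ J ih =>
    have hP := P.side_pos
    by_cases hPR : P.side ≤ R.side
    · by_cases hmeet : (R.toSet ∩ Metric.thickening P.side P.toSet).Nonempty
      · have hsub : P.toSet ⊆ Metric.closedBall R.center (5 * R.side / 2) := by
          obtain ⟨y, hyR, hyP⟩ := hmeet
          obtain ⟨z, hz, hyz⟩ := Metric.mem_thickening_iff.1 hyP
          intro x hx
          have h1 := R.toSet_subset_closedBall hyR
          have h2 := Cube.dist_le_side hx hz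
          rw [Metric.mem_closedBall] at h1 ⊢
          linarith [dist_triangle x z R.center, dist_triangle z y R.center, dist_comm y z]
        rw [inter_eq_left.2 hsub]
        refine le_trans (Finset.sum_le_sum fun j _ => ?_)
          (sum_volume_thickening_stopSet_le_volume hB hB' hf (J + 1) ha)
        split_ifs
        · exact measure_mono inter_subset_right
        · exact zero_le
      · refine le_of_eq_of_le (Finset.sum_eq_zero fun j _ => ?_) zero_le
        have : R.toSet ∩ Metric.thickening (P.side / 2 ^ (j + 1)) (stopSet f B j P a) = ∅ := by
          refine eq_empty_of_subset_empty ((inter_subset_inter_right _ ?_).trans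
            (not_nonempty_iff_eq_empty.1 hmeet).subset)
          exact (Metric.thickening_mono (div_le_self hP.le (one_le_pow₀ one_le_two)) _).trans
            (Metric.thickening_subset_of_subset _ (stopSet_subset _ _ _))
        simp [this]
    · rw [Finset.sum_range_succ', pow_zero, div_one, if_neg hPR, add_zero,
        P.volume_inter_eq_sum_child Metric.isClosed_closedBall.measurableSet, Finset.mul_sum]
      refine le_trans ?_ (Finset.sum_le_sum fun ε _ =>
        ih (P := P.child ε) (setLIntegral_nextValue_le hf (P.child ε) a))
      rw [Finset.sum_comm]
      refine Finset.sum_le_sum fun j _ => ?_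
      have hs : ∀ ε k, (P.child ε).side / 2 ^ k = P.side / 2 ^ (k + 1) := by
        intro ε k
        change P.side / 2 / _ = _
        rw [pow_succ' _ k, div_div]
      simp only [hs]
      split_ifs
      · rw [stopSet, Metric.thickening_iUnion, inter_iUnion]
        exact measure_iUnion_fintype_le _ _
      · exact zero_le

/-- The constants change by at most `2 ^ (n + 1) * B` at a stopped cube, since the mean estimate
holds on its parent with the old constant. -/
theorem enorm_nextValue_sub_le (hfi : LocallyIntegrable f volume) {P : Cube n} {a : ℝ}
    (ε : Fin n → Fin 2) (ha : ∫⁻ x in P.toSet, ‖f x - a‖ₑ ≤ 2 * B * volume P.toSet)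
    (hs : IsStopped f B (P.child ε) a) :
    ‖nextValue f B (P.child ε) a - a‖ₑ ≤ 2 ^ (n + 1) * B := by
  rw [nextValue, if_pos hs,
    ← ENNReal.mul_le_mul_iff_left (P.child ε).volume_ne_zero (P.child ε).volume_ne_top]
  calc _ ≤ ∫⁻ x in (P.child ε).toSet, ‖f x - a‖ₑ := enorm_mean_sub_mul_volume_le hfi _ _
    _ ≤ ∫⁻ x in P.toSet, ‖f x - a‖ₑ := lintegral_mono_set (P.child_subset ε)
    _ ≤ 2 * B * volume P.toSet := ha
    _ = _ := by rw [P.volume_child ε]; ring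

open Classical in
/-- The mean of `|f - b|` over a dyadic cube `P'` below `P` is controlled by the number of
stopping cubes between `P'` and `P`. -/
theorem setLAverage_le_of_isDescendant (hfi : LocallyIntegrable f volume)
    (hf : ∀ P : Cube n, ∫⁻ x in P.toSet, ‖f x - mean f P‖ₑ ≤ B * volume P.toSet)
    {k : ℕ} {P P' : Cube n} (hP : Cube.IsDescendant k P P') {a : ℝ} (b : ℝ)
    (ha : ∫⁻ x in P.toSet, ‖f x - a‖ₑ ≤ 2 * B * volume P.toSet)
    {x : Fin n → ℝ} (hx : x ∈ P'.toSet) :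
    (⨍⁻ y in P'.toSet, ‖f y - b‖ₑ ∂volume) ≤ 2 * B + ‖a - b‖ₑ +
      2 ^ (n + 1) * B * ∑ j ∈ Finset.range k, (stopSet f B j P a).indicator 1 x := by
  induction k generalizing P a with
  | zero =>
    rw [Cube.IsDescendant] at hP
    subst hP
    rw [setLAverage_eq]
    refine ENNReal.div_le_of_le_mul ?_
    simp only [Finset.range_zero, Finset.sum_empty, mul_zero, add_zero]
    calc _ ≤ ∫⁻ y in P'.toSet, (‖f y - a‖ₑ + ‖a - b‖ₑ) := by
          refine lintegral_mono fun y => ?_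
          rw [← sub_add_sub_cancel (f y) a b]
          exact enorm_add_le _ _
      _ = (∫⁻ y in P'.toSet, ‖f y - a‖ₑ) + ‖a - b‖ₑ * volume P'.toSet := by
          rw [lintegral_add_right _ measurable_const, setLIntegral_const]
      _ ≤ _ := by rw [add_mul]; gcongr
  | succ k ih =>
    obtain ⟨ε, hε⟩ := hP
    refine (ih hε (setLIntegral_nextValue_le hf (P.child ε) a)).trans ?_
    have hxε : x ∈ (P.child ε).toSet := hε.subset hx
    have h1 : ‖nextValue f B (P.child ε) a - b‖ₑ ≤
        ‖a - b‖ₑ + 2 ^ (n + 1) * B * (stopSet f B 0 P a).indicator 1 x := by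
      by_cases h : IsStopped f B (P.child ε) a
      · have hx0 : x ∈ stopSet f B 0 P a := mem_iUnion₂.2 ⟨ε, h, hxε⟩
        rw [indicator_of_mem hx0, Pi.one_apply, mul_one, add_comm,
          ← sub_add_sub_cancel (nextValue f B (P.child ε) a) a b]
        exact (enorm_add_le _ _).trans (add_le_add_left (enorm_nextValue_sub_le hfi ε ha h) _)
      · rw [nextValue, if_neg h]
        exact le_self_add
    rw [Finset.sum_range_succ']
    calc _ ≤ 2 * B + (‖a - b‖ₑ + 2 ^ (n + 1) * B * (stopSet f B 0 P a).indicator 1 x) +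
          2 ^ (n + 1) * B * ∑ j ∈ Finset.range k, (stopSet f B (j + 1) P a).indicator 1 x := by
          gcongr with j _
          exact subset_iUnion (fun ε => stopSet f B j (P.child ε)
            (nextValue f B (P.child ε) a)) ε
      _ = _ := by ring

end Stopping

/-! ### The sum of the bumps around the stopping cubes -/

theorem thickenedIndicatorAux_le_add_edist {α : Type*} [PseudoEMetricSpace α] {δ : ℝ}
    (E : Set α) (x y : α) :
    thickenedIndicatorAux δ E x ≤ thickenedIndicatorAux δ E y + edist x y / ENNReal.ofReal δ := by
  simp only [thickenedIndicatorAux]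
  rw [tsub_le_iff_right]
  have h : Metric.infEDist y E ≤ edist x y + Metric.infEDist x E := by
    rw [add_comm, edist_comm]
    exact Metric.infEDist_le_infEDist_add_edist
  calc (1 : ℝ≥0∞) ≤ 1 - Metric.infEDist y E / ENNReal.ofReal δ +
        Metric.infEDist y E / ENNReal.ofReal δ := le_tsub_add
    _ ≤ 1 - Metric.infEDist y E / ENNReal.ofReal δ +
        (edist x y + Metric.infEDist x E) / ENNReal.ofReal δ := by gcongr
    _ = _ := by rw [ENNReal.add_div, add_assoc]

theorem setLIntegral_thickenedIndicatorAux_le {δ : ℝ} (hδ : 0 < δ) (E S : Set (Fin n → ℝ)) :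
    ∫⁻ x in S, thickenedIndicatorAux δ E x ≤ volume (S ∩ Metric.thickening δ E) := by
  have hm : MeasurableSet (Metric.thickening δ E) := Metric.isOpen_thickening.measurableSet
  calc _ ≤ ∫⁻ x in S, (Metric.thickening δ E).indicator 1 x := by
        refine lintegral_mono fun x => ?_
        by_cases hx : x ∈ Metric.thickening δ E
        · rw [indicator_of_mem hx]
          exact thickenedIndicatorAux_le_one _ _ _
        · rw [thickenedIndicatorAux_zero hδ E hx]
          exact zero_le
    _ = _ := by rw [lintegral_indicator_one hm, Measure.restrict_apply hm, inter_comm]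

theorem enorm_toReal_sub_toReal_le {a b d : ℝ≥0∞} (hb : b ≠ ∞) (h₁ : a ≤ b + d)
    (h₂ : b ≤ a + d) : ‖a.toReal - b.toReal‖ₑ ≤ d := by
  by_cases hd : d = ∞
  · simp [hd]
  have ha : a ≠ ∞ := ne_top_of_le_ne_top (ENNReal.add_ne_top.2 ⟨hb, hd⟩) h₁
  lift a to ℝ≥0 using ha
  lift b to ℝ≥0 using hb
  lift d to ℝ≥0 using hd
  norm_cast at h₁ h₂
  rw [← ofReal_norm, Real.norm_eq_abs]
  refine ENNReal.ofReal_le_of_le_toReal (abs_le.2 ?_)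
  simp only [ENNReal.coe_toReal]
  have h₁' : (a : ℝ) ≤ b + d := by exact_mod_cast h₁
  have h₂' : (b : ℝ) ≤ a + d := by exact_mod_cast h₂
  constructor <;> linarith

theorem sum_range_div_le {l : ℝ} (hl : 0 < l) {r : ℝ} (hr : 0 < r) (m : ℕ) :
    ∑ j ∈ Finset.range m, r / (l / 2 ^ (j + 1)) ≤ 2 ^ (m + 1) * r / l := by
  induction m with
  | zero => simp; positivity
  | succ m ih =>
    rw [Finset.sum_range_succ]
    refine (add_le_add_left ih _).trans_eq ?_
    field_simp
    ring

section StopSum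

variable (f : (Fin n → ℝ) → ℝ) (B : ℝ≥0∞)

/-- The bump around the stopping cubes obtained from `Q` by `j + 1` subdivisions: it is `1` on
these cubes and decays linearly on the scale of their side length. -/
noncomputable def stopBump (Q : Cube n) (j : ℕ) : (Fin n → ℝ) → ℝ≥0∞ :=
  thickenedIndicatorAux (Q.side / 2 ^ (j + 1)) (stopSet f B j Q (mean f Q))

/-- The sum of the bumps around the stopping cubes of all generations. It is defined on the whole
space, and belongs to `BMO` there. -/
noncomputable def stopSum (Q : Cube n) (x : Fin n → ℝ) : ℝ≥0∞ :=
  ∑' j, stopBump f B Q j x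

variable {f B}

theorem measurable_stopBump (Q : Cube n) (j : ℕ) : Measurable (stopBump f B Q j) :=
  (continuous_thickenedIndicatorAux (div_pos Q.side_pos (by positivity)) _).measurable

theorem measurable_stopSum (Q : Cube n) : Measurable (stopSum f B Q) :=
  Measurable.tsum fun j => measurable_stopBump Q j

theorem setLIntegral_mean_le
    (hf : ∀ P : Cube n, ∫⁻ x in P.toSet, ‖f x - mean f P‖ₑ ≤ B * volume P.toSet) (Q : Cube n) :
    ∫⁻ x in Q.toSet, ‖f x - mean f Q‖ₑ ≤ 2 * B * volume Q.toSet := by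
  refine (hf Q).trans ?_
  gcongr
  exact le_mul_of_one_le_left zero_le one_le_two

theorem lintegral_stopSum_le (hB : B ≠ 0) (hB' : B ≠ ∞)
    (hf : ∀ P : Cube n, ∫⁻ x in P.toSet, ‖f x - mean f P‖ₑ ≤ B * volume P.toSet) (Q : Cube n) :
    ∫⁻ x, stopSum f B Q x ≤ 2 * 3 ^ n * volume Q.toSet := by
  simp only [stopSum]
  rw [lintegral_tsum fun j => (measurable_stopBump Q j).aemeasurable]
  refine ENNReal.tsum_le_of_sum_range_le fun J => le_trans (Finset.sum_le_sum fun j _ => ?_)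
    (sum_volume_thickening_stopSet_le_volume hB hB' hf J (setLIntegral_mean_le hf Q))
  have h := setLIntegral_thickenedIndicatorAux_le (div_pos Q.side_pos (by positivity))
    (stopSet f B j Q (mean f Q)) univ (δ := Q.side / 2 ^ (j + 1))
  rwa [setLIntegral_univ, univ_inter] at h

/-- On a cube `R` the bumps at the scales above the one of `R` have bounded oscillation, since
their Lipschitz constants sum up to at most `4 / R.side`, and the other ones have a bounded mean,
by the Carleson condition. -/
theorem exists_setLIntegral_stopSum_sub_le (hB : B ≠ 0) (hB' : B ≠ ∞)
    (hf : ∀ P : Cube n, ∫⁻ x in P.toSet, ‖f x - mean f P‖ₑ ≤ B * volume P.toSet)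
    (Q R : Cube n) :
    ∃ c : ℝ, ∫⁻ x in R.toSet, ‖(stopSum f B Q x).toReal - c‖ₑ ≤
      (4 + 2 * 15 ^ n) * volume R.toSet := by
  classical
  have hQ := Q.side_pos
  have hR := R.side_pos
  have hex : ∃ m : ℕ, Q.side / 2 ^ m ≤ R.side := by
    obtain ⟨m, hm⟩ := pow_unbounded_of_one_lt (Q.side / R.side) one_lt_two
    refine ⟨m, ?_⟩
    rw [div_lt_iff₀ hR] at hm
    rw [div_le_iff₀ (by positivity)]
    linarith
  -- For `j < m`, the bump `U j` belongs to cubes whose parents are longer than `R`.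
  set m := Nat.find hex
  set U := stopBump f B Q
  set L : (Fin n → ℝ) → ℝ≥0∞ := fun x => ∑ j ∈ Finset.range m, U j x
  set T : (Fin n → ℝ) → ℝ≥0∞ := fun x => ∑' j, U (j + m) x with hT
  have hLT : ∀ x, stopSum f B Q x = L x + T x := fun x =>
    (ENNReal.summable.sum_add_tsum_nat_add' (f := fun j => U j x)).symm
  have hTint : ∫⁻ x in R.toSet, T x ≤ 2 * 15 ^ n * volume R.toSet := by
    have h := fun N => sum_volume_inter_thickening_stopSet_le hB hB' hf (m + N) R
      (setLIntegral_mean_le hf Q)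
    have h5 := R.volume_closedBall_center (t := 5)
    push_cast at h5
    simp only [hT]
    rw [lintegral_tsum fun j => (measurable_stopBump Q _).aemeasurable]
    refine ENNReal.tsum_le_of_sum_range_le fun N => ?_
    calc _ ≤ ∑ j ∈ Finset.range N, (if Q.side / 2 ^ (m + j) ≤ R.side then
          volume (R.toSet ∩ Metric.thickening (Q.side / 2 ^ (m + j + 1))
            (stopSet f B (m + j) Q (mean f Q))) else 0) := by
          refine Finset.sum_le_sum fun j _ => ?_
          rw [if_pos, add_comm j m]
          · exact setLIntegral_thickenedIndicatorAux_le (div_pos hQ (by positivity)) _ _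
          · refine le_trans ?_ (Nat.find_spec hex)
            exact div_le_div_of_nonneg_left hQ.le (by positivity)
              (pow_le_pow_right₀ one_le_two (Nat.le_add_right _ _))
      _ ≤ _ := by
          rw [Finset.sum_range_add]
          exact le_add_self
      _ ≤ _ := h N
      _ ≤ 2 * 3 ^ n * volume (Metric.closedBall R.center (5 * R.side / 2)) := by
          gcongr
          exact inter_subset_right
      _ = _ := by
          rw [h5, show (15 : ℝ≥0∞) = 3 * 5 by norm_num, mul_pow]
          ring
  have hsum : ∀ x ∈ R.toSet, ∀ y ∈ R.toSet, L x ≤ L y + 4 := by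
    intro x hx y hy
    have hd : edist x y ≤ ENNReal.ofReal R.side := by
      rw [edist_dist]
      exact ENNReal.ofReal_le_ofReal (Cube.dist_le_side hx hy)
    have h4 : ∑ j ∈ Finset.range m, R.side / (Q.side / 2 ^ (j + 1)) ≤ 4 := by
      rcases hk : m with _ | k
      · simp
      · have hlt : ¬ Q.side / 2 ^ k ≤ R.side := Nat.find_min hex (by omega)
        rw [div_le_iff₀ (by positivity), not_le] at hlt
        refine (sum_range_div_le hQ hR _).trans ?_
        rw [div_le_iff₀ hQ, pow_succ, pow_succ]
        linarith
    calc L x ≤ ∑ j ∈ Finset.range m,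
          (U j y + ENNReal.ofReal (R.side / (Q.side / 2 ^ (j + 1)))) := by
          refine Finset.sum_le_sum fun j _ => ?_
          refine (thickenedIndicatorAux_le_add_edist _ x y).trans ?_
          rw [ENNReal.ofReal_div_of_pos (x := R.side)
            (by positivity : 0 < Q.side / 2 ^ (j + 1))]
          exact add_le_add le_rfl (ENNReal.div_le_div_right hd _)
      _ ≤ _ := by
          rw [Finset.sum_add_distrib, ← ENNReal.ofReal_sum_of_nonneg fun j _ => by positivity]
          gcongr
          exact ENNReal.ofReal_le_of_le_toReal (by simpa using h4)
  have hLfin : L R.corner ≠ ∞ := by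
    refine ne_of_lt (ENNReal.sum_lt_top.2 fun j _ => ?_)
    exact (thickenedIndicatorAux_le_one _ _ _).trans_lt ENNReal.one_lt_top
  refine ⟨(L R.corner).toReal, ?_⟩
  calc _ ≤ ∫⁻ x in R.toSet, (4 + T x) := by
        refine setLIntegral_mono' R.measurableSet_toSet fun x hx => ?_
        refine enorm_toReal_sub_toReal_le hLfin ?_ ?_
        · rw [hLT, ← add_assoc]
          gcongr
          exact hsum x hx _ R.corner_mem
        · refine (hsum _ R.corner_mem x hx).trans ?_
          rw [hLT]
          gcongr
          · exact le_self_add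
          · exact le_self_add
    _ = 4 * volume R.toSet + ∫⁻ x in R.toSet, T x := by
        rw [lintegral_add_left measurable_const, setLIntegral_const]
    _ ≤ _ := by
        rw [add_mul]
        gcongr

/-- The local maximal function is controlled by the number of stopping cubes around a point. -/
theorem localMaximal_le_stopSum (hfi : LocallyIntegrable f volume)
    (hf : ∀ P : Cube n, ∫⁻ x in P.toSet, ‖f x - mean f P‖ₑ ≤ B * volume P.toSet)
    (Q : Cube n) (x : Fin n → ℝ) :
    localMaximal Q (fun y => f y - mean f Q) x ≤ 2 ^ (n + 1) * B * (1 + stopSum f B Q x) := by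
  classical
  refine iSup₂_le fun P hP => ?_
  by_cases hx : x ∈ P.toSet
  swap
  · rw [indicator_of_notMem hx]
    exact zero_le
  obtain ⟨k, hk⟩ := hP.exists_isDescendant
  rw [indicator_of_mem hx]
  refine (setLAverage_le_of_isDescendant hfi hf hk (mean f Q)
    (setLIntegral_mean_le hf Q) hx).trans ?_
  rw [sub_self, enorm_zero, add_zero, mul_add, mul_one]
  gcongr
  · calc (2 : ℝ≥0∞) = 2 ^ 1 := (pow_one _).symm
      _ ≤ 2 ^ (n + 1) := pow_le_pow_right₀ one_le_two (by omega)
  · refine le_trans (Finset.sum_le_sum fun j _ => ?_) (ENNReal.sum_le_tsum (Finset.range k))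
    exact indicator_le_thickenedIndicatorAux _ _ x

end StopSum

/-! ### Domination of the maximal function by one oscillation -/

theorem mean_const_mul (b : ℝ) (f : (Fin n → ℝ) → ℝ) (Q : Cube n) :
    mean (fun x => b * f x) Q = b * mean f Q := by
  rw [mean, mean, setAverage_eq, setAverage_eq, integral_const_mul, smul_eq_mul, smul_eq_mul]
  ring

/-- After subtraction of a bounded function, the oscillation of a nonnegative `h` over `Q` dominates
`1 + h` *everywhere* on `Q`. The set `E` has measure between `2⁻¹ ^ (n + 1) * |Q|` and `|Q| / 2`,
so that the subtraction of a large multiple of its indicator function pushes the mean below the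
values of `h` off `E`, and the values on `E`, where `h` is bounded, below this mean. -/
theorem exists_one_add_le_abs_sub_mean (hn : n ≠ 0) {h : (Fin n → ℝ) → ℝ} (hm : Measurable h)
    (hi : LocallyIntegrable h volume) (h0 : ∀ x, 0 ≤ h x) {D : ℝ} (hD : 0 < D) (Q : Cube n)
    (hmean : mean h Q ≤ D) :
    ∃ E, MeasurableSet E ∧ ∀ x ∈ Q.toSet, 1 + h x ≤
      |(h x - 2 ^ (n + 1) * (1 + 2 * (2 ^ (n + 1) * D)) * E.indicator 1 x) -
        mean (fun y => h y - 2 ^ (n + 1) * (1 + 2 * (2 ^ (n + 1) * D)) * E.indicator 1 y) Q| := by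
  set H : ℝ := 2 ^ (n + 1) * D with hH
  set A : ℝ := 2 ^ (n + 1) * (1 + 2 * H) with hA
  have hHpos : 0 < H := by positivity
  have hDH : D ≤ H := le_mul_of_one_le_left hD.le (one_le_pow₀ one_le_two)
  set Q' := Q.child 0
  set E := Q'.toSet ∩ {x | h x < H}
  have hEm : MeasurableSet E :=
    Q'.measurableSet_toSet.inter (measurableSet_lt hm measurable_const)
  have hEQ : E ⊆ Q.toSet := inter_subset_left.trans (Q.child_subset 0)
  set v := volume.real Q.toSet with hv
  have hvpos : 0 < v := ENNReal.toReal_pos Q.volume_ne_zero Q.volume_ne_top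
  have hv' : v = 2 ^ n * volume.real Q'.toSet := by
    rw [hv, Measure.real, Q.volume_child 0, ENNReal.toReal_mul]
    simp [Measure.real, Q']
  set e := volume.real E with he
  have hint : ∫ x in Q.toSet, h x = v * mean h Q := by
    rw [mean, setAverage_eq, smul_eq_mul, ← mul_assoc, mul_inv_cancel₀ hvpos.ne', one_mul]
  have hup : 2 ^ n * e ≤ v := by
    rw [hv']
    gcongr
    exact measureReal_mono inter_subset_left Q'.volume_ne_top
  have hlow : v ≤ 2 ^ (n + 1) * e := by
    -- Chebyshev's inequality shows that `h` is below `H` on at least half of the child `Q'`.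
    have hcheb := mul_meas_ge_le_integral_of_nonneg (μ := volume.restrict Q.toSet)
      (ae_of_all _ h0) (hi.integrableOn_cube Q) H
    rw [hint, measureReal_restrict_apply (measurableSet_le measurable_const hm)] at hcheb
    have hsub : volume.real Q'.toSet ≤ e + volume.real ({x | H ≤ h x} ∩ Q.toSet) := by
      refine (measureReal_mono ?_ ?_).trans (measureReal_union_le _ _)
      · intro x hx
        by_cases hxH : h x < H
        · exact Or.inl ⟨hx, hxH⟩
        · exact Or.inr ⟨not_lt.1 hxH, Q.child_subset 0 hx⟩
      · exact ne_top_of_le_ne_top Q.volume_ne_top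
          (measure_mono (union_subset hEQ inter_subset_right))
    have h3 : 2 ^ (n + 1) * volume.real ({x | H ≤ h x} ∩ Q.toSet) ≤ v := by
      have : v * mean h Q ≤ v * D := by gcongr
      have h4 : (2 ^ (n + 1) * volume.real ({x | H ≤ h x} ∩ Q.toSet)) * D ≤ v * D := by
        rw [hH] at hcheb
        linarith
      exact le_of_mul_le_mul_right h4 hD
    have h5 := mul_le_mul_of_nonneg_left hsub (by positivity : (0 : ℝ) ≤ 2 ^ (n + 1))
    rw [mul_add] at h5
    have h6 : 2 * v = 2 ^ (n + 1) * volume.real Q'.toSet := by rw [hv', pow_succ]; ring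
    linarith
  set θ := e / v with hθ
  have hθlow : 1 ≤ 2 ^ (n + 1) * θ := by
    rw [hθ, ← mul_div_assoc, le_div_iff₀ hvpos]
    linarith
  have hθup : 2 * θ ≤ 1 := by
    rw [hθ, ← mul_div_assoc, div_le_one hvpos]
    refine le_trans ?_ hup
    gcongr
    exact le_self_pow₀ one_le_two hn
  have hmean' : mean (fun y => h y - A * E.indicator 1 y) Q = mean h Q - A * θ := by
    have hiE : IntegrableOn (E.indicator (1 : (Fin n → ℝ) → ℝ)) Q.toSet volume :=
      (integrableOn_const (C := (1 : ℝ)) Q.volume_ne_top).indicator hEm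
    rw [mean, setAverage_eq, integral_sub (hi.integrableOn_cube Q) (hiE.const_mul A),
      integral_const_mul, integral_indicator_one hEm, measureReal_restrict_apply hEm,
      inter_eq_left.2 hEQ, hint, smul_eq_mul, ← hv, ← he, hθ]
    field_simp
  have hmean0 : 0 ≤ mean h Q := by
    rw [mean, setAverage_eq]
    exact smul_nonneg (inv_nonneg.2 hvpos.le) (integral_nonneg h0)
  have hAθ : 1 + 2 * H ≤ A * θ := by
    have := mul_le_mul_of_nonneg_right hθlow (by positivity : 0 ≤ 1 + 2 * H)
    rw [hA]
    linarith
  have hAH : 2 * (1 + 2 * H) ≤ A := by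
    rw [hA]
    gcongr
    exact le_self_pow₀ one_le_two n.succ_ne_zero
  refine ⟨E, hEm, fun x _ => ?_⟩
  rw [hmean']
  by_cases hx : x ∈ E
  · rw [indicator_of_mem hx, Pi.one_apply, mul_one]
    have hxH : h x < H := hx.2
    have : A * (2 * θ) ≤ A * 1 := mul_le_mul_of_nonneg_left hθup (by positivity)
    refine le_trans ?_ (neg_le_abs _)
    linarith
  · rw [indicator_of_notMem hx, mul_zero, sub_zero]
    refine le_trans ?_ (le_abs_self _)
    linarith

/-- The factor by which `exists_bmoNorm_le_and_localMaximal_le` increases the norm in `BMO`. It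
depends on the dimension only. -/
noncomputable def dominationConst (n : ℕ) : ℝ≥0 :=
  2 * (2 ^ (n + 1) * (4 + 2 * 15 ^ n + 2 ^ (n + 1) * (1 + 2 * (2 ^ (n + 1) * (2 * 3 ^ n)))))

/-- In dimension zero there is only one point, so that `f` agrees with its mean. -/
theorem localMaximal_eq_zero_of_dim_zero (hn : n = 0) (f : (Fin n → ℝ) → ℝ) (Q : Cube n)
    (x : Fin n → ℝ) : localMaximal Q (fun y => f y - mean f Q) x = 0 := by
  subst hn
  have h : ∀ y, f y - mean f Q = 0 := by
    intro y
    rw [mean, show f = fun _ => f y from funext fun z => congrArg f (Subsingleton.elim z y),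
      setAverage_const Q.volume_ne_zero Q.volume_ne_top, sub_self]
  simp [localMaximal, h]

/-- The local maximal function of `f ∈ BMO` is dominated on `Q` by the oscillation over `Q` of a
function in `BMO` of comparable norm. -/
theorem exists_bmoNorm_le_and_localMaximal_le {f : (Fin n → ℝ) → ℝ}
    (hfi : LocallyIntegrable f volume) {B : ℝ≥0} (hB : bmoNorm f < B) (Q : Cube n) :
    ∃ g, LocallyIntegrable g volume ∧ bmoNorm g ≤ dominationConst n * B ∧
      ∀ᵐ x ∂volume.restrict Q.toSet,
        localMaximal Q (fun y => f y - mean f Q) x ≤ ‖g x - mean g Q‖ₑ := by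
  rcases eq_or_ne n 0 with hn | hn
  · refine ⟨0, locallyIntegrable_zero, ?_, ae_of_all _ fun x => ?_⟩
    · simp [bmoNorm, mean]
    · rw [localMaximal_eq_zero_of_dim_zero hn]
      exact zero_le
  have hB0 : (B : ℝ≥0∞) ≠ 0 := (zero_le.trans_lt hB).ne'
  have hf : ∀ P : Cube n, ∫⁻ x in P.toSet, ‖f x - mean f P‖ₑ ≤ B * volume P.toSet := fun P =>
    (setLIntegral_le_bmoNorm f P).trans (mul_le_mul_left hB.le _)
  have hint := lintegral_stopSum_le hB0 ENNReal.coe_ne_top hf Q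
  have hfin : ∫⁻ x, stopSum f B Q x ≠ ∞ := ne_top_of_le_ne_top
    (ENNReal.mul_ne_top (ENNReal.mul_ne_top (by simp) (by simp)) Q.volume_ne_top) hint
  have hSm := measurable_stopSum (f := f) (B := B) Q
  have hae : ∀ᵐ x, stopSum f B Q x < ∞ := ae_lt_top hSm hfin
  set h : (Fin n → ℝ) → ℝ := fun x => (stopSum f B Q x).toReal
  have hi : Integrable h volume := integrable_toReal_of_lintegral_ne_top hSm.aemeasurable hfin
  have hv : 0 < volume.real Q.toSet := ENNReal.toReal_pos Q.volume_ne_zero Q.volume_ne_top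
  have hmean : mean h Q ≤ 2 * 3 ^ n := by
    rw [mean, setAverage_eq, integral_toReal hSm.aemeasurable (ae_restrict_of_ae hae), smul_eq_mul,
      inv_mul_le_iff₀ hv]
    have h1 := (setLIntegral_le_lintegral Q.toSet _).trans hint
    have h2 := ENNReal.toReal_mono (ENNReal.mul_ne_top (by finiteness) Q.volume_ne_top) h1
    rw [ENNReal.toReal_mul] at h2
    refine h2.trans_eq ?_
    rw [mul_comm]
    simp [Measure.real]
  obtain ⟨E, hEm, hE⟩ := exists_one_add_le_abs_sub_mean hn hSm.ennreal_toReal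
    hi.locallyIntegrable (fun _ => ENNReal.toReal_nonneg) (by positivity) Q hmean
  set A : ℝ≥0 := 2 ^ (n + 1) * (1 + 2 * (2 ^ (n + 1) * (2 * 3 ^ n))) with hA
  have hA' : (2 : ℝ) ^ (n + 1) * (1 + 2 * (2 ^ (n + 1) * (2 * 3 ^ n))) = A := by
    rw [hA]; push_cast; rfl
  simp only [hA'] at hE
  set b : ℝ≥0 := 2 ^ (n + 1) * B with hb
  have hiE : LocallyIntegrable (E.indicator (1 : (Fin n → ℝ) → ℝ)) volume :=
    (locallyIntegrable_const (1 : ℝ)).indicator hEm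
  have hgi : LocallyIntegrable (fun x => (b : ℝ) * (h x - A * E.indicator 1 x)) volume :=
    (hi.locallyIntegrable.sub (hiE.smul (A : ℝ))).smul (b : ℝ)
  refine ⟨fun x => b * (h x - A * E.indicator 1 x), hgi, ?_, ?_⟩
  · refine (bmoNorm_le_of_forall_exists hgi (K := b * (4 + 2 * 15 ^ n + A)) fun R => ?_).trans_eq ?_
    · obtain ⟨c, hc⟩ := exists_setLIntegral_stopSum_sub_le hB0 ENNReal.coe_ne_top hf Q R
      refine ⟨b * c, ?_⟩
      calc _ ≤ ∫⁻ x in R.toSet, b * (‖h x - c‖ₑ + A) := by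
            refine lintegral_mono fun x => ?_
            rw [← mul_sub, enorm_mul, sub_right_comm]
            have hbn : ‖(b : ℝ)‖ₑ = b := by simp
            rw [hbn]
            gcongr
            refine enorm_sub_le.trans ?_
            gcongr
            rw [enorm_mul]
            have hAn : ‖(A : ℝ)‖ₑ = A := by simp
            rw [hAn]
            refine mul_le_of_le_one_right zero_le ?_
            by_cases hx : x ∈ E <;> simp [hx]
        _ = b * ((∫⁻ x in R.toSet, ‖h x - c‖ₑ) + A * volume R.toSet) := by
            rw [lintegral_const_mul' _ _ ENNReal.coe_ne_top,
              lintegral_add_right _ measurable_const, setLIntegral_const]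
        _ ≤ b * ((4 + 2 * 15 ^ n) * volume R.toSet + A * volume R.toSet) := by gcongr
        _ = _ := by ring
    · rw [dominationConst, hb, hA]
      push_cast
      ring
  · filter_upwards [ae_restrict_of_ae hae, ae_restrict_mem Q.measurableSet_toSet] with x hx hxQ
    refine (localMaximal_le_stopSum hfi hf Q x).trans ?_
    rw [mean_const_mul, ← mul_sub, enorm_mul]
    have hbn : ‖(b : ℝ)‖ₑ = 2 ^ (n + 1) * B := by
      rw [Real.enorm_of_nonneg NNReal.zero_le_coe, ENNReal.ofReal_coe_nnreal, hb]
      push_cast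
      rfl
    rw [hbn]
    gcongr
    rw [← ofReal_norm, Real.norm_eq_abs]
    refine le_trans ?_ (ENNReal.ofReal_le_ofReal (hE x hxQ))
    rw [ENNReal.ofReal_add zero_le_one ENNReal.toReal_nonneg, ENNReal.ofReal_one,
      ENNReal.ofReal_toReal hx.ne]

/-! ### Quasi-norms of extended-real functions -/

namespace QuasiBanachFunctionSpace

variable {α : Type*} [MeasurableSpace α] {μ : Measure α} (X : QuasiBanachFunctionSpace μ)

/-- The extended quasi-norm is monotone. Here `F` has to be a.e. equal to a measurable real
function `u`, while nothing is assumed on `G`. -/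
theorem eNorm_le_of_ae_le {F G : α → EReal} {u : α → ℝ} (hu : AEStronglyMeasurable u μ)
    (hF : (fun x => (u x : EReal)) =ᵐ[μ] F) (hle : ∀ᵐ x ∂μ, ‖u x‖ₑ ≤ (G x).abs) :
    X.eNorm F ≤ X.eNorm G := by
  refine le_iInf₂ fun g hg => ?_
  have habs : |AEEqFun.mk u hu| ≤ |g.1| := by
    rw [← AEEqFun.coeFn_le]
    filter_upwards [AEEqFun.coeFn_abs (AEEqFun.mk u hu), AEEqFun.coeFn_abs g.1,
      AEEqFun.coeFn_mk u hu, hg, hle] with x h1 h2 h3 h4 h5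
    rw [h1, h2, h3]
    rw [← h4, EReal.abs_def, ← ofReal_norm, Real.norm_eq_abs] at h5
    exact (ENNReal.ofReal_le_ofReal_iff (abs_nonneg _)).1 h5
  refine iInf₂_le_of_le ⟨AEEqFun.mk u hu, X.ideal g _ habs⟩ ?_
    (ENNReal.ofReal_le_ofReal (X.compat _ _ habs))
  filter_upwards [AEEqFun.coeFn_mk u hu, hF] with x h1 h2
  rw [← h2, h1]

theorem ofReal_mul_eNorm_le {a : ℝ} (ha : 0 < a) (u : α → ℝ) :
    ENNReal.ofReal a * X.eNorm (fun x => (u x : EReal)) ≤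
      X.eNorm fun x => ((a * u x : ℝ) : EReal) := by
  refine le_iInf₂ fun g hg => ?_
  have h : X.eNorm (fun x => (u x : EReal)) ≤ ENNReal.ofReal (X.qnorm (a⁻¹ • g)) := by
    refine iInf₂_le_of_le (a⁻¹ • g) ?_ le_rfl
    filter_upwards [AEEqFun.coeFn_smul a⁻¹ g.1, hg] with x h1 h2
    rw [EReal.coe_eq_coe_iff] at h2 ⊢
    change (a⁻¹ • g.1) x = _
    rw [h1, Pi.smul_apply, h2, smul_eq_mul, inv_mul_cancel_left₀ ha.ne']
  rw [X.qnorm_smul, abs_of_pos (inv_pos.2 ha)] at h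
  calc _ ≤ ENNReal.ofReal a * ENNReal.ofReal (a⁻¹ * X.qnorm g) := by gcongr
    _ = _ := by rw [← ENNReal.ofReal_mul ha.le, mul_inv_cancel_left₀ ha.ne']

end QuasiBanachFunctionSpace

theorem abs_coe_ennreal (t : ℝ≥0∞) : (t : EReal).abs = t := by
  induction t with
  | top => rfl
  | coe t =>
    change ((t : ℝ) : EReal).abs = t
    rw [EReal.abs_def, abs_of_nonneg NNReal.zero_le_coe, ENNReal.ofReal_coe_nnreal]

theorem measurable_localMaximal (Q : Cube n) (f : (Fin n → ℝ) → ℝ) :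
    Measurable (localMaximal Q f) :=
  Measurable.biSup {P | Q.IsDyadic P} Q.countable_isDyadic fun P _ =>
    measurable_const.indicator P.measurableSet_toSet

theorem setLAverage_le_localMaximal {Q P : Cube n} (h : Q.IsDyadic P) (f : (Fin n → ℝ) → ℝ)
    {x : Fin n → ℝ} (hx : x ∈ P.toSet) :
    (⨍⁻ y in P.toSet, ‖f y‖ₑ ∂volume) ≤ localMaximal Q f x := by
  refine le_iSup₂_of_le P h ?_
  rw [indicator_of_mem hx]

/-- The Lebesgue differentiation theorem along dyadic cubes. -/
theorem ae_enorm_le_localMaximal {f : (Fin n → ℝ) → ℝ} (hf : LocallyIntegrable f volume)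
    (Q : Cube n) : ∀ᵐ x ∂volume.restrict Q.toSet, ‖f x‖ₑ ≤ localMaximal Q f x := by
  filter_upwards [ae_restrict_of_ae (IsUnifLocDoublingMeasure.ae_tendsto_average volume hf 1),
    ae_restrict_mem Q.measurableSet_toSet] with x hx hxQ
  choose P hP hxP hs using Cube.exists_isDyadic_mem hxQ
  have hlim := hx (l := atTop) (fun k => (P k).center) (fun k => (P k).side / 2) ?_ ?_
  · refine le_of_tendsto (hlim.enorm) (Eventually.of_forall fun k => ?_)
    refine le_trans ?_ (setLAverage_le_localMaximal (hP k) f (hxP k))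
    rw [← setAverage_congr (P k).toSet_ae_eq_closedBall]
    exact enorm_integral_le_lintegral_enorm _
  · refine tendsto_nhdsWithin_iff.2 ⟨?_, Eventually.of_forall fun k => half_pos (P k).side_pos⟩
    simp only [hs]
    have h := ((tendsto_pow_atTop_nhds_zero_of_lt_one (r := (1 / 2 : ℝ)) (by norm_num)
      (by norm_num)).const_mul Q.side).div_const 2
    rw [mul_zero, zero_div] at h
    refine h.congr fun k => ?_
    rw [one_div, inv_pow, div_eq_mul_inv Q.side]
  · refine Eventually.of_forall fun k => ?_
    rw [one_mul]
    exact (P k).toSet_subset_closedBall (hxP k)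

/-! ### The embeddings -/

theorem locallyIntegrable_sub_mean {f : (Fin n → ℝ) → ℝ} (hf : LocallyIntegrable f volume)
    (Q : Cube n) : LocallyIntegrable (fun x => f x - mean f Q) volume :=
  hf.sub (locallyIntegrable_const _)

/-- Consequence of `|f - ⟨f⟩_Q| ≤ M_Q (f - ⟨f⟩_Q)` almost everywhere on `Q`. -/
theorem bmoXNorm_le_bmoMXNorm (X : Family n) {f : (Fin n → ℝ) → ℝ}
    (hf : LocallyIntegrable f volume) : bmoXNorm X f ≤ bmoMXNorm X f := by
  refine iSup_mono fun Q => ?_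
  have hi := locallyIntegrable_sub_mean hf Q
  refine (X Q).eNorm_le_of_ae_le (hi.integrableOn_cube Q).aestronglyMeasurable ae_eq_rfl ?_
  simpa only [abs_coe_ennreal] using ae_enorm_le_localMaximal hi Q

/-- The maximal function is at least the mean over `Q` itself, and the indicator function of `Q`
has quasi-norm at least `c`. -/
theorem mul_bmoNorm_le_bmoMXNorm {X : Family n} {c : ℝ≥0}
    (hc : ∀ Q : Cube n, (c : ℝ≥0∞) ≤ (X Q).eNorm (Q.toSet.indicator fun _ => 1))
    {f : (Fin n → ℝ) → ℝ} (hf : LocallyIntegrable f volume) :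
    c * bmoNorm f ≤ bmoMXNorm X f := by
  rw [bmoNorm, ENNReal.mul_iSup]
  refine iSup_mono fun Q => ?_
  set t := ⨍⁻ x in Q.toSet, ‖f x - mean f Q‖ₑ ∂volume with ht
  have htop : t ≠ ∞ := by
    rw [ht, setLAverage_eq]
    exact ENNReal.div_ne_top
      ((locallyIntegrable_sub_mean hf Q).integrableOn_cube Q).hasFiniteIntegral.ne
      Q.volume_ne_zero
  rcases eq_or_ne t 0 with h0 | h0
  · rw [h0, mul_zero]
    exact zero_le
  have hpos : 0 < t.toReal := ENNReal.toReal_pos h0 htop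
  have hone : (X Q).eNorm (Q.toSet.indicator fun _ => 1) ≤
      (X Q).eNorm fun _ => ((1 : ℝ) : EReal) := by
    refine (X Q).eNorm_le_of_ae_le (u := fun _ => 1) aestronglyMeasurable_const ?_ ?_
    · filter_upwards [ae_restrict_mem Q.measurableSet_toSet] with x hx
      rw [indicator_of_mem hx, EReal.coe_one]
    · exact ae_of_all _ fun x => by rw [EReal.abs_def]; simp
  calc c * t ≤ ENNReal.ofReal t.toReal * (X Q).eNorm fun _ => ((1 : ℝ) : EReal) := by
        rw [ENNReal.ofReal_toReal htop, mul_comm]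
        gcongr
        exact (hc Q).trans hone
    _ ≤ (X Q).eNorm fun _ => ((t.toReal * 1 : ℝ) : EReal) :=
        (X Q).ofReal_mul_eNorm_le hpos fun _ => 1
    _ ≤ _ := by
        refine (X Q).eNorm_le_of_ae_le (u := fun _ => t.toReal * 1) aestronglyMeasurable_const
          ae_eq_rfl ?_
        filter_upwards [ae_restrict_mem Q.measurableSet_toSet] with x hx
        rw [abs_coe_ennreal, mul_one, Real.enorm_of_nonneg ENNReal.toReal_nonneg,
          ENNReal.ofReal_toReal htop]
        exact setLAverage_le_localMaximal .refl _ hx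

theorem bmoMXNorm_le_of_embeds {X : Family n} {C : ℝ≥0} (hC : C ≠ 0)
    (h : ∀ g ∈ space bmoNorm, bmoXNorm X g ≤ C * bmoNorm (n := n) g)
    {f : (Fin n → ℝ) → ℝ} (hf : f ∈ space bmoNorm) :
    bmoMXNorm X f ≤ (C * dominationConst n : ℝ≥0) * bmoNorm f := by
  have hK : ((C * dominationConst n : ℝ≥0) : ℝ≥0∞) ≠ 0 := by
    rw [ENNReal.coe_ne_zero]
    exact mul_ne_zero hC (by unfold dominationConst; positivity)
  rw [mul_comm, ← ENNReal.div_le_iff hK ENNReal.coe_ne_top]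
  -- The stopping cubes need a positive level `B`, also if `bmoNorm f = 0`; hence `B` is taken
  -- slightly above `bmoNorm f`.
  refine ENNReal.le_of_forall_pos_le_add fun δ hδ _ => ?_
  obtain ⟨B, hB⟩ : ∃ B : ℝ≥0, bmoNorm f + δ = B :=
    ⟨_, (ENNReal.coe_toNNReal (ENNReal.add_ne_top.2 ⟨hf.2.ne, ENNReal.coe_ne_top⟩)).symm⟩
  have hlt : bmoNorm f < B := by
    rw [← hB]
    exact ENNReal.lt_add_right hf.2.ne (by simpa using hδ.ne')
  rw [hB, ENNReal.div_le_iff hK ENNReal.coe_ne_top]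
  refine iSup_le fun Q => ?_
  obtain ⟨g, hgi, hgB, hg⟩ := exists_bmoNorm_le_and_localMaximal_le hf.1 hlt Q
  have hgs : g ∈ space bmoNorm := ⟨hgi, hgB.trans_lt (by finiteness)⟩
  calc _ ≤ (X Q).eNorm fun x => ((g x - mean g Q : ℝ) : EReal) := by
        have hfin : ∀ᵐ x ∂volume.restrict Q.toSet,
            localMaximal Q (fun y => f y - mean f Q) x ≠ ∞ := by
          filter_upwards [hg] with x hx
          exact ne_top_of_le_ne_top enorm_ne_top hx
        refine (X Q).eNorm_le_of_ae_le
          (u := fun x => (localMaximal Q (fun y => f y - mean f Q) x).toReal)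
          (measurable_localMaximal Q _).ennreal_toReal.aestronglyMeasurable ?_ ?_
        · filter_upwards [hfin] with x hx
          exact EReal.coe_ennreal_toReal hx
        · filter_upwards [hfin, hg] with x hx hxg
          rw [EReal.abs_def, Real.enorm_of_nonneg ENNReal.toReal_nonneg,
            ENNReal.ofReal_toReal hx, ← Real.norm_eq_abs, ofReal_norm]
          exact hxg
    _ ≤ bmoXNorm X g :=
        le_iSup (fun Q => (X Q).eNorm fun x => ((g x - mean g Q : ℝ) : EReal)) Q
    _ ≤ C * bmoNorm g := h g hgs
    _ ≤ C * (dominationConst n * B) := by gcongr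
    _ = _ := by push_cast; ring

end BMOX

theorem mainTheorem4 (n : ℕ) (X : BMOX.Family n) (hX : X.IsNormalized) :
    BMOX.Embeds BMOX.bmoNorm (BMOX.bmoXNorm X) ↔
      BMOX.SameSpace BMOX.bmoNorm (BMOX.bmoMXNorm X) := by
  obtain ⟨c, _, hc, hcX⟩ := hX
  constructor
  · rintro ⟨-, C, hC, h⟩
    have hK : 0 < C * BMOX.dominationConst n :=
      mul_pos hC (by unfold BMOX.dominationConst; positivity)
    have hle : ∀ f ∈ BMOX.space BMOX.bmoNorm,
        BMOX.bmoMXNorm X f ≤ (C * BMOX.dominationConst n : ℝ≥0) * BMOX.bmoNorm f := fun f hf =>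
      BMOX.bmoMXNorm_le_of_embeds hC.ne' h hf
    refine ⟨Subset.antisymm (fun f hf => ⟨hf.1, ?_⟩) (fun f hf => ⟨hf.1, ?_⟩), c,
      C * BMOX.dominationConst n, hc, hK, fun f hf =>
        ⟨BMOX.mul_bmoNorm_le_bmoMXNorm (fun Q => (hcX Q).1) hf.1, hle f hf⟩⟩
    · exact (hle f hf).trans_lt (ENNReal.mul_lt_top ENNReal.coe_lt_top hf.2)
    · have h1 := (BMOX.mul_bmoNorm_le_bmoMXNorm (fun Q => (hcX Q).1) hf.1).trans_lt hf.2
      exact ENNReal.lt_top_of_mul_ne_top_right h1.ne (by simpa using hc.ne')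
  · rintro ⟨hs, _, C, _, hC, h⟩
    refine ⟨fun f hf => ⟨hf.1, ?_⟩, C, hC, fun f hf => ?_⟩
    · exact (BMOX.bmoXNorm_le_bmoMXNorm X hf.1).trans_lt (hs ▸ hf).2
    · exact (BMOX.bmoXNorm_le_bmoMXNorm X hf.1).trans (h f hf).2
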